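/- Let $\mathcal N$ be a countable index set, $\ell^q=\ell^q(\mathcal N)$ $(1\le q\le\infty)$ the real sequence spaces, and $\mathcal B(\ell^q)$ the Banach algebra of bounded linear operators on $\ell^q$. Let $\mathcal A$ be a Banach algebra of infinite matrices $A=(a(i,j))_{i,j\in\mathcal N}$ which contains the identity matrix $I$, is closed under transposition, and is (with continuous inclusion) a Banach subalgebra of $\mathcal B(\ell^q)$ for every $1\le q\le\infty$. Assume that: (a) there are finite sets $\mathcal N_1\subset\mathcal N_2\subset\cdots$ with $\bigcup_m\mathcal N_m=\mathcal N$ such that the projections $P_mx=x\chi_{\mathcal N_m}$ satisfy $$\lim_{m\to\infty}\ \sup_{\|A\|_{\mathcal A}\le1}\|P_mA(I-P_{m+1})\|_{\mathcal B(\ell^\infty)}=0;$$ (b) there are $C_0\in(0,\infty)$ and $\theta\in[0,1)$ such that for all $A,B\in\mathcal A$ $$\|AB\|_{\mathcal A}\le C_0\big(\|A\|_{\mathcal A}\|B\|_{\mathcal A}^{\theta}\|B\|_{\mathcal B(\ell^2)}^{1-\theta}+\|B\|_{\mathcal A}\|A\|_{\mathcal A}^{\theta}\|A\|_{\mathcal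 B(\ell^2)}^{1-\theta}\big).$$ Let $2\le p_0\le\infty$, and let $f$ be a continuous function on $\ell^{p_0}$ with $f(0)=0$ whose gradient $\nabla f(x)c=\lim_{t\to0}\big(f(x+tc)-f(x)\big)/t$ $(x,c\in\ell^{p_0})$ belongs to $\mathcal A$, is continuous as a map from $\ell^{p_0}$ to $\mathcal A$ and bounded, say $\sup_{z\in\ell^{p_0}}\|\nabla f(z)\|_{\mathcal A}\le M$, and satisfies, for some $m_0>0$, $$c^T\nabla f(x)c\ge m_0\,c^Tc\qquad\text{for all }c\in\ell^2,\ x\in\ell^{p_0}.$$ Set $L=\sup_{z\in\ell^{p_0}}\|\nabla f(z)\|_{\mathcal B(\ell^2)}$. Let $1\le p\le p_0$ and $0<\alpha<m_0/(L+L^2)$. Then $f$ maps $\ell^p$ bijectively onto $\ell^p$, and for all $y,x_0\in\ell^p$ the Van-Cittert iteration $$x_n=x_{n-1}-\alpha\big(f(x_{n-1})-y\big),\qquad n\ge1,$$ stays in $\ell^p$ and converges exponentially in $\ell^p$ to the unique solution $f^{-1}(y)\in\ell^p$ of $f(x)=y$: there are $C<\infty$ and $r\in(0,1)$ with $\|x_n-f^{-1}(y)\|_p\le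 Cr^n$ for all $n\ge0$. Moreover, for every $$r>\frac{1-\alpha+\alpha^2L+\alpha^2L^2}{1-\alpha+\alpha m_0}$$ one has $$\|x_n-f^{-1}(y)\|_p\le C_1\,\|x_0-f^{-1}(y)\|_p\,r^n\qquad\text{for all }n\ge0,$$ where $C_1>0$ depends only on $\alpha,r,p,\mathcal A,m_0,L$ and $M$ (so not on $p_0$, $y$, $x_0$, nor otherwise on $f$). -/

import Mathlib

open Filter Topology
open scoped ENNReal

/-- The real sequence space `ℓ^q(N)` with its norm `‖·‖_q`. -/
abbrev SeqSpace (N : Type*) (q : ℝ≥0∞) : Type _ := lp (fun _ : N => ℝ) q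

/-- The inclusion `ℓ^p ⊆ ℓ^q` for `p ≤ q`. -/
noncomputable def seqIncl (N : Type*) {p q : ℝ≥0∞} (h : p ≤ q) :
    SeqSpace N p →ₗ[ℝ] SeqSpace N q :=
  lp.linearMapOfLE ℝ (fun _ : N => ℝ) h

/-- The bounded operator `T` on `ℓ^q` is given by the infinite matrix `a`:
`(T x)(i) = ∑_j a(i,j) x(j)` for all `x ∈ ℓ^q` and all `i`. -/
def ActsAs {N : Type*} (q : ℝ≥0∞) [Fact (1 ≤ q)] (a : Matrix N N ℝ)
    (T : SeqSpace N q →L[ℝ] SeqSpace N q) : Prop :=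
  ∀ (x : SeqSpace N q) (i : N), HasSum (fun j => a i j * x j) (T x i)

/-- The infinite matrix `a` belongs to `B(ℓ^q)`. -/
def IsBoundedMatrix {N : Type*} (q : ℝ≥0∞) [Fact (1 ≤ q)] (a : Matrix N N ℝ) : Prop :=
  ∃ T : SeqSpace N q →L[ℝ] SeqSpace N q, ActsAs q a T

open Classical in
/-- The (unique) bounded operator on `ℓ^q` given by a matrix `a ∈ B(ℓ^q)`; it is `0` by convention
if `a` does not belong to `B(ℓ^q)`. -/
noncomputable def matrixOp {N : Type*} (q : ℝ≥0∞) [Fact (1 ≤ q)] (a : Matrix N N ℝ) :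
    SeqSpace N q →L[ℝ] SeqSpace N q :=
  if h : IsBoundedMatrix q a then h.choose else 0

theorem actsAs_matrixOp {N : Type*} {q : ℝ≥0∞} [Fact (1 ≤ q)] {a : Matrix N N ℝ}
    (h : IsBoundedMatrix q a) : ActsAs q a (matrixOp q a) := by
  rw [matrixOp, dif_pos h]
  exact h.choose_spec

theorem ActsAs.unique {N : Type*} {q : ℝ≥0∞} [Fact (1 ≤ q)] {a : Matrix N N ℝ}
    {T T' : SeqSpace N q →L[ℝ] SeqSpace N q} (h : ActsAs q a T) (h' : ActsAs q a T') : T = T' := by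
  ext x i
  exact (h x i).unique (h' x i)

/-- The Banach algebra `𝒜` (a complete normed algebra with its own norm), whose elements are
identified with infinite matrices through the injective linear map `entry`, is a Banach algebra of
infinite matrices which contains the identity matrix and is a Banach subalgebra of `B(ℓ^q)` for all
`1 ≤ q ≤ ∞`: its unit is the identity matrix, its product is the matrix product, and all its
members belong to `B(ℓ^q)`, with continuous inclusion `𝒜 ⊆ B(ℓ^q)`. -/
structure IsMatrixBanachAlgebra {N 𝒜 : Type*} [NormedRing 𝒜] [NormedAlgebra ℝ 𝒜]
    (entry : 𝒜 →ₗ[ℝ] Matrix N N ℝ) : Prop where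
  complete : CompleteSpace 𝒜
  injective : Function.Injective entry
  one_diag : ∀ i : N, entry 1 i i = 1
  one_offDiag : ∀ i j : N, i ≠ j → entry 1 i j = 0
  mul : ∀ (A B : 𝒜) (i k : N), HasSum (fun j => entry A i j * entry B j k) (entry (A * B) i k)
  bounded : ∀ (q : ℝ≥0∞) [Fact (1 ≤ q)] (A : 𝒜), IsBoundedMatrix q (entry A)
  continuous_incl : ∀ (q : ℝ≥0∞) [Fact (1 ≤ q)],
    ∃ K : ℝ, ∀ A : 𝒜, ‖matrixOp q (entry A)‖ ≤ K * ‖A‖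

/-- The algebra of matrices is closed under the transpose operation. -/
def ClosedUnderTranspose {N 𝒜 : Type*} [NormedRing 𝒜] [NormedAlgebra ℝ 𝒜]
    (entry : 𝒜 →ₗ[ℝ] Matrix N N ℝ) : Prop :=
  ∀ A : 𝒜, ∃ B : 𝒜, entry B = (entry A).transpose

open Classical in
/-- The projection `P_S x = x χ_S` on `ℓ^∞`, for a finite set `S` of indices. -/
noncomputable def cutoff {N : Type*} (S : Finset N) : SeqSpace N ∞ →L[ℝ] SeqSpace N ∞ :=
  ∑ i ∈ S, (lp.singleContinuousLinearMap ℝ (fun _ : N => ℝ) ∞ i).comp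
    (lp.evalCLM ℝ (fun _ : N => ℝ) ∞ i)

open Classical in
theorem cutoff_apply {N : Type*} (S : Finset N) (x : SeqSpace N ∞) (i : N) :
    cutoff S x i = if i ∈ S then x i else 0 := by
  simp only [cutoff, sum_apply, lp.coeFn_sum, Finset.sum_apply]
  have h : ∀ j ∈ S, (((lp.singleContinuousLinearMap ℝ (fun _ : N => ℝ) ∞ j).comp
      (lp.evalCLM ℝ (fun _ : N => ℝ) ∞ j)) x) i = if i = j then x j else 0 := by
    intro j _
    by_cases hij : i = j
    · subst hij
      simp only [ContinuousLinearMap.comp_apply, lp.singleContinuousLinearMap_apply,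
        lp.single_apply_self, if_true]
      rfl
    · simp [hij]
  rw [Finset.sum_congr rfl h]
  simp

/-- There are finite sets `N_0 ⊆ N_1 ⊆ …` of indices with union `N` such that
`sup_{‖A‖_𝒜 ≤ 1} ‖P_m A (I - P_{m+1})‖_{B(ℓ^∞)} → 0`, where `P_m` is the projection to `N_m`. -/
def HasOffDiagonalDecay {N 𝒜 : Type*} [NormedRing 𝒜] [NormedAlgebra ℝ 𝒜]
    (entry : 𝒜 →ₗ[ℝ] Matrix N N ℝ) : Prop :=
  ∃ S : ℕ → Finset N, Monotone S ∧ (∀ i : N, ∃ m, i ∈ S m) ∧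
    Tendsto (fun m => ⨆ (A : 𝒜) (_ : ‖A‖ ≤ 1),
      ‖(cutoff (S m)).comp ((matrixOp ∞ (entry A)).comp
        (ContinuousLinearMap.id ℝ (SeqSpace N ∞) - cutoff (S (m + 1))))‖ₑ) atTop (𝓝 0)

/-- The differential norm inequality, with constants `C₀ ∈ (0, ∞)` and `θ ∈ [0, 1)`. -/
def HasDifferentialNorm {N 𝒜 : Type*} [NormedRing 𝒜] [NormedAlgebra ℝ 𝒜]
    (entry : 𝒜 →ₗ[ℝ] Matrix N N ℝ) : Prop :=
  ∃ C₀ θ : ℝ, 0 < C₀ ∧ 0 ≤ θ ∧ θ < 1 ∧ ∀ A B : 𝒜,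
    ‖A * B‖ ≤ C₀ * (‖A‖ * ‖B‖ ^ θ * ‖matrixOp 2 (entry B)‖ ^ (1 - θ) +
      ‖B‖ * ‖A‖ ^ θ * ‖matrixOp 2 (entry A)‖ ^ (1 - θ))

/-- `f` is a continuous function on `ℓ^{p₀}` with `f(0) = 0`; its gradient `∇f(x)`, where
`∇f(x) c = lim_{t → 0} (f(x + t c) - f(x)) / t`, is (the operator of the matrix) `G x ∈ 𝒜`; it is
bounded by `M` and continuous in `𝒜`; it satisfies the strict monotonicity property
`cᵀ ∇f(x) c ≥ m₀ cᵀ c` for all `c ∈ ℓ²` and `x ∈ ℓ^{p₀}`; and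
`L = sup_x ‖∇f(x)‖_{B(ℓ²)}`. -/
structure IsStrictlyMonotoneWithGradient {N 𝒜 : Type*} [NormedRing 𝒜] [NormedAlgebra ℝ 𝒜]
    (entry : 𝒜 →ₗ[ℝ] Matrix N N ℝ) (p₀ : ℝ≥0∞) [Fact (1 ≤ p₀)]
    (f : SeqSpace N p₀ → SeqSpace N p₀) (G : SeqSpace N p₀ → 𝒜) (m₀ L M : ℝ) : Prop where
  continuous : Continuous f
  map_zero : f 0 = 0
  gradient : ∀ x c : SeqSpace N p₀, HasLineDerivAt ℝ f (matrixOp p₀ (entry (G x)) c) x c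
  gradient_continuous : Continuous G
  gradient_bounded : ∀ x, ‖G x‖ ≤ M
  strictMono : ∀ (x : SeqSpace N p₀) (c : SeqSpace N 2),
    m₀ * inner ℝ c c ≤ inner ℝ c (matrixOp 2 (entry (G x)) c)
  isLUB : IsLUB (Set.range fun x => ‖matrixOp 2 (entry (G x))‖) L

/-- The Van-Cittert iteration `x_n = x_{n-1} - α (g(x_{n-1}) - y)` started at `x₀`. -/
def vanCittert {E : Type*} [AddCommGroup E] [Module ℝ E] (g : E → E) (α : ℝ) (y x₀ : E) : ℕ → E
  | 0 => x₀
  | n + 1 => vanCittert g α y x₀ n - α • (g (vanCittert g α y x₀ n) - y)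

/-!
The increments of `f` are given by matrices in `𝒜`: by the mean value theorem
(`IsStrictlyMonotoneWithGradient.exists_sub_eq`), `f x - f x' = A (x - x')`, where `A` is the average
of the gradients of `f` over the segment from `x'` to `x`, hence an element of `𝒜`. It acts on
`ℓ^p` and on `ℓ^{p₀}` alike, and as `f 0 = 0`, the function `f` maps `ℓ^p` to itself. The difference
of two Van-Cittert sequences for the same right-hand side is therefore the initial difference
multiplied by a product of `n` matrices `I - α A`
(`IsStrictlyMonotoneWithGradient.exists_vanCittert_sub_eq`).

Let `ρ` be the rate `(1 - α + α² L + α² L²) / (1 - α + α m₀)`. Strict monotonicity gives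
`‖I - α A‖² ≤ 1 - 2 α m₀ + α² L² ≤ ρ²` in `B(ℓ²)` (`norm_id_sub_smul_le`, `rate_sq_bound`), so the
products of `n` factors have norm at most `ρ ^ n` in `B(ℓ²)`. In `𝒜` the factors are only known to
be bounded, but the differential norm inequality, used to pass from `2 ^ k` to `2 ^ (k + 1)` factors,
transfers the exponential rate from `B(ℓ²)` to `𝒜`: products of `n` factors have norm at most
`C r ^ n` in `𝒜` for each `r > ρ` (`exists_norm_list_prod_le`), where `C` depends on `f` through
`m₀`, `L` and `M` only. By the continuous inclusion of `𝒜` in `B(ℓ^p)`, the same holds in `B(ℓ^p)`.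

Since `ρ < 1`, high iterates of `x ↦ x - α (f x - y)` are contractions of `ℓ^p`, so this map has
exactly one fixed point (`bijective_of_vanCittert_contracting`). This gives the bijectivity of `f` on
`ℓ^p`, and comparison of a Van-Cittert sequence with the one that is constantly the fixed point gives
the estimates.
-/

/-! ### Infinite matrices as bounded operators on `ℓ^q` -/

section MatrixOperators

variable {N : Type*}

theorem seqIncl_apply {p q : ℝ≥0∞} (h : p ≤ q) (x : SeqSpace N p) (i : N) :
    seqIncl N h x i = x i := rfl

theorem seqIncl_injective {p q : ℝ≥0∞} (h : p ≤ q) : Function.Injective (seqIncl N h) := by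
  intro x y hxy
  ext i
  rw [← seqIncl_apply h x, hxy, seqIncl_apply]

theorem ActsAs.matrixOp_eq {q : ℝ≥0∞} [Fact (1 ≤ q)] {a : Matrix N N ℝ}
    {T : SeqSpace N q →L[ℝ] SeqSpace N q} (h : ActsAs q a T) : matrixOp q a = T :=
  (actsAs_matrixOp ⟨T, h⟩).unique h

theorem seqIncl_matrixOp {p q : ℝ≥0∞} [Fact (1 ≤ p)] [Fact (1 ≤ q)] (h : p ≤ q)
    {a : Matrix N N ℝ} (hp : IsBoundedMatrix p a) (hq : IsBoundedMatrix q a) (x : SeqSpace N p) :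
    seqIncl N h (matrixOp p a x) = matrixOp q a (seqIncl N h x) := by
  ext i
  exact (actsAs_matrixOp hp x i).unique (actsAs_matrixOp hq (seqIncl N h x) i)

/-- Testing the operator on the sign pattern of the `i`-th row shows that the rows of a matrix in
`B(ℓ^∞)` are uniformly absolutely summable. -/
theorem summable_abs_row_and_tsum_le {a : Matrix N N ℝ} (h : IsBoundedMatrix ∞ a) (i : N) :
    Summable (fun j => |a i j|) ∧ ∑' j, |a i j| ≤ ‖matrixOp ∞ a‖ := by
  have hbd : ∀ j, ‖(SignType.sign (a i j) : ℝ)‖ ≤ 1 := by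
    intro j
    rcases lt_trichotomy (a i j) 0 with h | h | h <;> simp [h]
  let x : SeqSpace N ∞ := ⟨fun j => (SignType.sign (a i j) : ℝ),
    memℓp_infty ⟨1, by rintro _ ⟨j, rfl⟩; exact hbd j⟩⟩
  have hx : ‖x‖ ≤ 1 := lp.norm_le_of_forall_le zero_le_one hbd
  have hs : HasSum (fun j => |a i j|) (matrixOp ∞ a x i) := by
    have := actsAs_matrixOp h x i
    simpa only [x, self_mul_sign] using this
  refine ⟨hs.summable, hs.tsum_eq.le.trans ?_⟩
  calc matrixOp ∞ a x i ≤ ‖matrixOp ∞ a x i‖ := Real.le_norm_self _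
    _ ≤ ‖matrixOp ∞ a x‖ := lp.norm_apply_le_norm ENNReal.top_ne_zero _ i
    _ ≤ ‖matrixOp ∞ a‖ * 1 := (matrixOp ∞ a).le_opNorm_of_le hx
    _ = _ := mul_one _

/-- On `ℓ^∞` the matrix product acts as the composition: the double series converges absolutely
by `summable_abs_row_and_tsum_le`, so the order of summation may be changed. -/
theorem actsAs_comp_top {a b c : Matrix N N ℝ} (ha : IsBoundedMatrix ∞ a)
    (hb : IsBoundedMatrix ∞ b) (hc : ∀ i k, HasSum (fun j => a i j * b j k) (c i k)) :
    ActsAs ∞ c (matrixOp ∞ a ∘L matrixOp ∞ b) := by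
  intro x i
  have hrow : ∀ k, Summable fun j => |a i k * b k j * x j| := by
    intro k
    refine Summable.of_nonneg_of_le (fun _ => abs_nonneg _) (fun j => ?_)
      (((summable_abs_row_and_tsum_le hb k).1.mul_left |a i k|).mul_right ‖x‖)
    rw [abs_mul, abs_mul]
    gcongr
    exact lp.norm_apply_le_norm ENNReal.top_ne_zero x j
  have hsum : Summable fun kj : N × N => a i kj.1 * b kj.1 kj.2 * x kj.2 := by
    refine Summable.of_abs ((summable_prod_of_nonneg fun _ => abs_nonneg _).2 ⟨hrow, ?_⟩)
    refine Summable.of_nonneg_of_le (fun k => tsum_nonneg fun _ => abs_nonneg _) (fun k => ?_)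
      ((summable_abs_row_and_tsum_le ha i).1.mul_right (‖matrixOp ∞ b‖ * ‖x‖))
    have hbk := summable_abs_row_and_tsum_le hb k
    calc ∑' j, |a i k * b k j * x j| ≤ ∑' j, |a i k| * |b k j| * ‖x‖ := by
          refine (hrow k).tsum_le_tsum (fun j => ?_) ((hbk.1.mul_left _).mul_right _)
          rw [abs_mul, abs_mul]
          gcongr
          exact lp.norm_apply_le_norm ENNReal.top_ne_zero x j
      _ = |a i k| * (∑' j, |b k j|) * ‖x‖ := by rw [tsum_mul_right, tsum_mul_left]
      _ ≤ |a i k| * (‖matrixOp ∞ b‖ * ‖x‖) := by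
          rw [mul_assoc]
          gcongr
          exact hbk.2
  have hcol : ∀ j, HasSum (fun k => a i k * b k j * x j) (c i j * x j) :=
    fun j => (hc i j).mul_right _
  have htot : HasSum (fun kj : N × N => a i kj.1 * b kj.1 kj.2 * x kj.2)
      (matrixOp ∞ a (matrixOp ∞ b x) i) := by
    have h1 := hsum.hasSum.prod_fiberwise (g := fun k => a i k * matrixOp ∞ b x k) fun k => by
      simpa only [mul_assoc] using (actsAs_matrixOp hb x k).mul_left (a i k)
    rw [(actsAs_matrixOp ha (matrixOp ∞ b x) i).unique h1]
    exact hsum.hasSum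
  have hswap := (Equiv.prodComm N N).hasSum_iff.2 htot
  exact hswap.prod_fiberwise hcol

theorem actsAs_comp {q : ℝ≥0∞} [Fact (1 ≤ q)] {a b c : Matrix N N ℝ}
    (ha : IsBoundedMatrix q a) (hb : IsBoundedMatrix q b) (ha' : IsBoundedMatrix ∞ a)
    (hb' : IsBoundedMatrix ∞ b) (hc : ∀ i k, HasSum (fun j => a i j * b j k) (c i k)) :
    ActsAs q c (matrixOp q a ∘L matrixOp q b) := by
  intro x i
  have h := actsAs_comp_top ha' hb' hc (seqIncl N le_top x) i
  rw [ContinuousLinearMap.comp_apply, ← seqIncl_matrixOp le_top hb hb',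
    ← seqIncl_matrixOp le_top ha ha'] at h
  exact h

variable {𝒜 : Type*} [NormedRing 𝒜] [NormedAlgebra ℝ 𝒜] {entry : 𝒜 →ₗ[ℝ] Matrix N N ℝ}

namespace IsMatrixBanachAlgebra

/-- The continuous inclusion `𝒜 ⊆ B(ℓ^q)`. -/
noncomputable def toOp (h : IsMatrixBanachAlgebra entry) (q : ℝ≥0∞) [Fact (1 ≤ q)] :
    𝒜 →L[ℝ] (SeqSpace N q →L[ℝ] SeqSpace N q) :=
  LinearMap.mkContinuousOfExistsBound
    { toFun := fun A => matrixOp q (entry A)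
      map_add' := fun A B => ActsAs.matrixOp_eq fun x i => by
        have hA := actsAs_matrixOp (h.bounded q A) x i
        have hB := actsAs_matrixOp (h.bounded q B) x i
        simpa [add_mul] using hA.add hB
      map_smul' := fun r A => ActsAs.matrixOp_eq fun x i => by
        have hA := actsAs_matrixOp (h.bounded q A) x i
        simpa [mul_assoc] using hA.mul_left r }
    (h.continuous_incl q)

theorem toOp_apply (h : IsMatrixBanachAlgebra entry) (q : ℝ≥0∞) [Fact (1 ≤ q)] (A : 𝒜) :
    h.toOp q A = matrixOp q (entry A) := rfl

theorem toOp_one (h : IsMatrixBanachAlgebra entry) (q : ℝ≥0∞) [Fact (1 ≤ q)] :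
    h.toOp q 1 = ContinuousLinearMap.id ℝ (SeqSpace N q) := by
  refine ActsAs.matrixOp_eq fun x i => ?_
  have : HasSum (fun j => entry 1 i j * x j) (entry 1 i i * x i) :=
    hasSum_single i fun j hj => by rw [h.one_offDiag i j hj.symm, zero_mul]
  simpa [h.one_diag] using this

theorem toOp_mul (h : IsMatrixBanachAlgebra entry) (q : ℝ≥0∞) [Fact (1 ≤ q)] (A B : 𝒜) :
    h.toOp q (A * B) = h.toOp q A ∘L h.toOp q B :=
  ActsAs.matrixOp_eq <| actsAs_comp (h.bounded q A) (h.bounded q B) (h.bounded ∞ A)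
    (h.bounded ∞ B) (h.mul A B)

theorem seqIncl_toOp (h : IsMatrixBanachAlgebra entry) {p q : ℝ≥0∞} [Fact (1 ≤ p)]
    [Fact (1 ≤ q)] (hpq : p ≤ q) (A : 𝒜) (x : SeqSpace N p) :
    seqIncl N hpq (h.toOp p A x) = h.toOp q A (seqIncl N hpq x) :=
  seqIncl_matrixOp hpq (h.bounded p A) (h.bounded q A) x

theorem norm_toOp_list_prod_le (h : IsMatrixBanachAlgebra entry) (q : ℝ≥0∞) [Fact (1 ≤ q)]
    {ρ : ℝ} (hρ : 0 ≤ ρ) (l : List 𝒜) (hl : ∀ B ∈ l, ‖h.toOp q B‖ ≤ ρ) :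
    ‖h.toOp q l.prod‖ ≤ ρ ^ l.length := by
  induction l with
  | nil => simpa [h.toOp_one] using ContinuousLinearMap.norm_id_le
  | cons B l ih =>
    rw [List.prod_cons, h.toOp_mul, List.length_cons, pow_succ']
    refine (ContinuousLinearMap.opNorm_comp_le _ _).trans ?_
    have hB := hl B (by simp)
    have hl' := ih fun B hB => hl B (by simp [hB])
    gcongr

end IsMatrixBanachAlgebra

end MatrixOperators

/-! ### Growth of products in the matrix algebra -/

section Products

theorem List.norm_prod_le_pow {R : Type*} [NormedRing R] {K : ℝ} (hK : 0 ≤ K) (l : List R)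
    (hl : ∀ B ∈ l, ‖B‖ ≤ K) : ‖l.prod‖ ≤ ‖(1 : R)‖ * K ^ l.length := by
  induction l with
  | nil => simp
  | cons B l ih =>
    have hB := hl B (by simp)
    have hl' := ih fun B hB => hl B (by simp [hB])
    rw [List.prod_cons, List.length_cons]
    calc ‖B * l.prod‖ ≤ ‖B‖ * ‖l.prod‖ := norm_mul_le _ _
      _ ≤ K * (‖(1 : R)‖ * K ^ l.length) := by gcongr
      _ = _ := by ring

/-- If the products of exactly `m` factors from `D` are bounded by `r ^ m`, then all products of
factors from `D` are bounded by `C * r ^ n`, `n` being the number of factors. -/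
theorem exists_norm_list_prod_le_of_length_eq {R : Type*} [NormedRing R] {D : Set R} {K r : ℝ}
    {m : ℕ} (hm : 0 < m) (hr : 0 < r) (hD : ∀ B ∈ D, ‖B‖ ≤ K)
    (h : ∀ l : List R, (∀ B ∈ l, B ∈ D) → l.length = m → ‖l.prod‖ ≤ r ^ m) :
    ∃ C : ℝ, 0 < C ∧ ∀ l : List R, (∀ B ∈ l, B ∈ D) → ‖l.prod‖ ≤ C * r ^ l.length := by
  set κ : ℝ := max K r with hκ
  have hκr : 1 ≤ κ / r := (one_le_div hr).2 (le_max_right _ _)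
  have hκ0 : 0 < κ := hr.trans_le (le_max_right _ _)
  refine ⟨(‖(1 : R)‖ + 1) * (κ / r) ^ m, by positivity, fun l => ?_⟩
  induction hn : l.length using Nat.strong_induction_on generalizing l with
  | _ n ih =>
    intro hl
    rcases lt_or_ge n m with hnm | hnm
    · have h1 := List.norm_prod_le_pow hκ0.le l fun B hB => (hD B (hl B hB)).trans (le_max_left _ _)
      rw [hn] at h1
      calc ‖l.prod‖ ≤ ‖(1 : R)‖ * κ ^ n := h1
        _ ≤ (‖(1 : R)‖ + 1) * κ ^ n := by gcongr; linarith
        _ = (‖(1 : R)‖ + 1) * (κ / r) ^ n * r ^ n := by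
          rw [mul_assoc, ← mul_pow, div_mul_cancel₀ _ hr.ne']
        _ ≤ _ := by gcongr
    · have h1 := h (l.take m) (fun B hB => hl B (List.mem_of_mem_take hB)) (by simp [hn, hnm])
      have h2 := ih (n - m) (by omega) (l.drop m) (by simp [hn])
        fun B hB => hl B (List.mem_of_mem_drop hB)
      rw [← List.prod_take_mul_prod_drop l m]
      calc ‖(l.take m).prod * (l.drop m).prod‖ ≤ ‖(l.take m).prod‖ * ‖(l.drop m).prod‖ :=
            norm_mul_le _ _
        _ ≤ r ^ m * ((‖(1 : R)‖ + 1) * (κ / r) ^ m * r ^ (n - m)) := by gcongr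
        _ = (‖(1 : R)‖ + 1) * (κ / r) ^ m * (r ^ m * r ^ (n - m)) := by ring
        _ = _ := by rw [← pow_add, Nat.add_sub_cancel' hnm]

variable {N 𝒜 : Type*} [NormedRing 𝒜] [NormedAlgebra ℝ 𝒜] {entry : 𝒜 →ₗ[ℝ] Matrix N N ℝ}

/-- Squaring step, iterated: the differential norm inequality bounds products of `2 ^ k` factors by
`ρ ^ (2 ^ k)` times a factor that is subexponential in the number `2 ^ k`, since `1 + θ < 2`. -/
theorem norm_list_prod_two_pow_le (h𝒜 : IsMatrixBanachAlgebra entry) {C₀ θ : ℝ} (hC₀ : 0 < C₀)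
    (hθ : 0 ≤ θ) (hθ' : θ < 1)
    (hdiff : ∀ A B : 𝒜, ‖A * B‖ ≤ C₀ * (‖A‖ * ‖B‖ ^ θ * ‖matrixOp 2 (entry B)‖ ^ (1 - θ) +
      ‖B‖ * ‖A‖ ^ θ * ‖matrixOp 2 (entry A)‖ ^ (1 - θ)))
    {ρ u d : ℝ} (hρ : 0 < ρ) (hd : 0 ≤ d) (hCd : 2 * C₀ ≤ Real.exp d) {D : Set 𝒜}
    (hu : ∀ B ∈ D, ‖B‖ ≤ ρ * Real.exp u) (hD : ∀ B ∈ D, ‖h𝒜.toOp 2 B‖ ≤ ρ) (k : ℕ)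
    (l : List 𝒜) (hl : ∀ B ∈ l, B ∈ D) (hlen : l.length = 2 ^ k) :
    ‖l.prod‖ ≤ ρ ^ (2 ^ k) * Real.exp ((1 + θ) ^ k * (u + d * k)) := by
  induction k generalizing l with
  | zero =>
    obtain ⟨B, rfl⟩ := List.length_eq_one_iff.1 (by simpa using hlen)
    simpa using hu B (hl B (by simp))
  | succ k ih =>
    set w : ℝ := (1 + θ) ^ k * (u + d * k) with hw
    have hlen1 : (l.take (2 ^ k)).length = 2 ^ k := by
      rw [List.length_take, hlen, pow_succ]; omega
    have hlen2 : (l.drop (2 ^ k)).length = 2 ^ k := by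
      rw [List.length_drop, hlen, pow_succ]; omega
    have hl1 : ∀ B ∈ l.take (2 ^ k), B ∈ D := fun B hB => hl B (List.mem_of_mem_take hB)
    have hl2 : ∀ B ∈ l.drop (2 ^ k), B ∈ D := fun B hB => hl B (List.mem_of_mem_drop hB)
    have hP := ih _ hl1 hlen1
    have hQ := ih _ hl2 hlen2
    have hP2 := h𝒜.norm_toOp_list_prod_le 2 hρ.le _ fun B hB => hD B (hl1 B hB)
    have hQ2 := h𝒜.norm_toOp_list_prod_le 2 hρ.le _ fun B hB => hD B (hl2 B hB)
    rw [hlen1, h𝒜.toOp_apply] at hP2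
    rw [hlen2, h𝒜.toOp_apply] at hQ2
    rw [← List.prod_take_mul_prod_drop l (2 ^ k)]
    set P := (l.take (2 ^ k)).prod
    set Q := (l.drop (2 ^ k)).prod
    set s : ℝ := ρ ^ (2 ^ k) with hs
    have hs0 : 0 < s := by positivity
    have hθ1 : 0 ≤ 1 - θ := by linarith
    set X : ℝ := s * Real.exp w with hX
    have hX0 : 0 < X := by positivity
    have key : X * X ^ θ * s ^ (1 - θ) = s ^ 2 * Real.exp ((1 + θ) * w) := by
      rw [hX, Real.mul_rpow hs0.le (Real.exp_pos _).le, ← Real.exp_mul]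
      have e1 : s ^ θ * s ^ (1 - θ) = s := by
        rw [← Real.rpow_add hs0]; simp
      have e2 : Real.exp w * Real.exp (w * θ) = Real.exp ((1 + θ) * w) := by
        rw [← Real.exp_add]; ring_nf
      calc s * Real.exp w * (s ^ θ * Real.exp (w * θ)) * s ^ (1 - θ)
          = s * (s ^ θ * s ^ (1 - θ)) * (Real.exp w * Real.exp (w * θ)) := by ring
        _ = _ := by rw [e1, e2]; ring
    calc ‖P * Q‖ ≤ C₀ * (‖P‖ * ‖Q‖ ^ θ * ‖matrixOp 2 (entry Q)‖ ^ (1 - θ) +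
          ‖Q‖ * ‖P‖ ^ θ * ‖matrixOp 2 (entry P)‖ ^ (1 - θ)) := hdiff P Q
      _ ≤ C₀ * (X * X ^ θ * s ^ (1 - θ) + X * X ^ θ * s ^ (1 - θ)) := by gcongr
      _ = 2 * C₀ * (s ^ 2 * Real.exp ((1 + θ) * w)) := by rw [key]; ring
      _ ≤ Real.exp d * (s ^ 2 * Real.exp ((1 + θ) * w)) := by gcongr
      _ = ρ ^ (2 ^ (k + 1)) * Real.exp (d + (1 + θ) * w) := by
        rw [Real.exp_add, hs, ← pow_mul, ← pow_succ]; ring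
      _ ≤ _ := by
        gcongr
        have h1 : 1 ≤ (1 + θ) ^ (k + 1) := one_le_pow₀ (by linarith)
        rw [hw]
        push_cast
        rw [pow_succ] at h1 ⊢
        nlinarith [mul_le_mul_of_nonneg_left h1 hd]

/-- Products of `n` factors from a set that is bounded in `𝒜` grow in `𝒜` at most at the exponential
rate at which they grow in `B(ℓ²)`. -/
theorem exists_norm_list_prod_le (h𝒜 : IsMatrixBanachAlgebra entry)
    (hdiff : HasDifferentialNorm entry) {K ρ r : ℝ} (hρ : 0 < ρ) (hr : ρ < r) :
    ∃ C : ℝ, 0 < C ∧ ∀ l : List 𝒜, (∀ B ∈ l, ‖B‖ ≤ K ∧ ‖h𝒜.toOp 2 B‖ ≤ ρ) →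
      ‖l.prod‖ ≤ C * r ^ l.length := by
  obtain ⟨C₀, θ, hC₀, hθ, hθ', hdiff⟩ := hdiff
  have hr0 := hρ.trans hr
  set d : ℝ := |Real.log (2 * C₀)| with hd
  set u : ℝ := Real.log (max K ρ / ρ) with hu
  have hK0 : 0 < max K ρ := hρ.trans_le (le_max_right _ _)
  have hCd : 2 * C₀ ≤ Real.exp d := by
    rw [← Real.log_le_iff_le_exp (by positivity)]
    exact le_abs_self _
  have hKu : max K ρ = ρ * Real.exp u := by
    rw [hu, Real.exp_log (by positivity), mul_div_cancel₀ _ hρ.ne']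
  set σ : ℝ := (1 + θ) / 2 with hσ
  have hσ0 : 0 ≤ σ := by positivity
  have hσ1 : σ < 1 := by rw [hσ]; linarith
  have hlim : Tendsto (fun k : ℕ => u * σ ^ k + d * (k * σ ^ k)) atTop (𝓝 0) := by
    simpa using ((tendsto_pow_atTop_nhds_zero_of_lt_one hσ0 hσ1).const_mul u).add
      ((tendsto_self_mul_const_pow_of_lt_one hσ0 hσ1).const_mul d)
  have hlog : 0 < Real.log (r / ρ) := Real.log_pos ((one_lt_div hρ).2 hr)
  obtain ⟨k, hk⟩ := (hlim.eventually_lt_const hlog).exists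
  refine exists_norm_list_prod_le_of_length_eq (D := {B | ‖B‖ ≤ K ∧ ‖h𝒜.toOp 2 B‖ ≤ ρ})
    (K := K) (m := 2 ^ k) (by positivity) hr0 (fun B hB => hB.1) fun l hl hlen => ?_
  refine (norm_list_prod_two_pow_le h𝒜 hC₀ hθ hθ' hdiff hρ (abs_nonneg _) hCd
    (fun B hB => (hB.1.trans (le_max_left _ _)).trans hKu.le) (fun B hB => hB.2) k l hl
    hlen).trans ?_
  have hexp : (1 + θ) ^ k * (u + d * k) ≤ Real.log (r / ρ) * (2 ^ k : ℕ) := by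
    have e : (1 + θ) ^ k = σ ^ k * 2 ^ k := by rw [hσ, ← mul_pow]; congr 1; ring
    calc (1 + θ) ^ k * (u + d * k) = (u * σ ^ k + d * (k * σ ^ k)) * 2 ^ k := by rw [e]; ring
      _ ≤ _ := by push_cast; gcongr
  calc ρ ^ (2 ^ k) * Real.exp ((1 + θ) ^ k * (u + d * k))
      ≤ ρ ^ (2 ^ k) * Real.exp (Real.log (r / ρ) * (2 ^ k : ℕ)) := by gcongr
    _ = r ^ (2 ^ k) := by
      rw [Real.exp_mul, Real.exp_log (by positivity), Real.rpow_natCast, ← mul_pow,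
        mul_div_cancel₀ _ hρ.ne']

end Products

/-! ### The Van-Cittert iteration in a Banach space -/

section Iteration

variable {E : Type*} [NormedAddCommGroup E] [NormedSpace ℝ E]

theorem vanCittert_succ' (g : E → E) (α : ℝ) (y x : E) (n : ℕ) :
    vanCittert g α y x (n + 1) = vanCittert g α y (x - α • (g x - y)) n := by
  induction n with
  | zero => rfl
  | succ n ih => rw [vanCittert, ih, vanCittert]

theorem vanCittert_of_eq {g : E → E} {α : ℝ} {y x : E} (h : g x = y) (n : ℕ) :
    vanCittert g α y x n = x := by
  induction n with
  | zero => rfl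
  | succ n ih => simp [vanCittert, ih, h]

/-- If some iterate of the Van-Cittert map `x ↦ x - α (g x - y)` is a contraction for every `y`,
then this map has exactly one fixed point, which is the solution of `g x = y`. -/
theorem bijective_of_vanCittert_contracting [CompleteSpace E] {g : E → E} {α C r : ℝ}
    (hα : α ≠ 0) (hr0 : 0 ≤ r) (hr1 : r < 1)
    (h : ∀ y x x' : E, ∀ n,
      ‖vanCittert g α y x n - vanCittert g α y x' n‖ ≤ C * ‖x - x'‖ * r ^ n) :
    Function.Bijective g := by
  constructor
  · intro x x' hxx
    have hlim : Tendsto (fun n : ℕ => C * ‖x - x'‖ * r ^ n) atTop (𝓝 0) := by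
      simpa using (tendsto_pow_atTop_nhds_zero_of_lt_one hr0 hr1).const_mul (C * ‖x - x'‖)
    have hle : ‖x - x'‖ ≤ 0 := ge_of_tendsto' hlim fun n => by
      simpa [vanCittert_of_eq rfl, vanCittert_of_eq hxx.symm] using h (g x) x x' n
    exact sub_eq_zero.1 (norm_le_zero_iff.1 hle)
  · intro y
    have hcont : Continuous fun x => x - α • (g x - y) := by
      refine (LipschitzWith.of_dist_le_mul (K := (C * r).toNNReal) fun x x' => ?_).continuous
      have h1 := h y x x' 1
      simp only [vanCittert, pow_one] at h1
      rw [dist_eq_norm, dist_eq_norm]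
      calc _ ≤ C * ‖x - x'‖ * r := h1
        _ = C * r * ‖x - x'‖ := by ring
        _ ≤ _ := by gcongr; exact Real.le_coe_toNNReal _
    have hcau : CauchySeq (vanCittert g α y 0) := by
      refine cauchySeq_of_le_geometric r (C * ‖0 - (0 - α • (g 0 - y))‖) hr1 fun n => ?_
      rw [dist_eq_norm, vanCittert_succ']
      exact h y _ _ n
    obtain ⟨z, hz⟩ := cauchySeq_tendsto_of_complete hcau
    have hfix : z - α • (g z - y) = z :=
      tendsto_nhds_unique ((hcont.tendsto z).comp hz) ((tendsto_add_atTop_iff_nat 1).2 hz)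
    refine ⟨z, sub_eq_zero.1 ?_⟩
    simpa [hα] using hfix

end Iteration

/-! ### Contraction in `B(ℓ²)` -/

section Monotone

/-- The bound for `‖I - α T‖²` is obtained by expanding the square; the second estimate compares
it with the rate of the Van-Cittert iteration. -/
theorem norm_id_sub_smul_le {H : Type*} [NormedAddCommGroup H] [InnerProductSpace ℝ H]
    {T : H →L[ℝ] H} {α m L ρ : ℝ} (hα : 0 ≤ α) (hρ : 0 ≤ ρ)
    (hρ' : 1 - 2 * (α * m) + (α * L) ^ 2 ≤ ρ ^ 2)
    (hm : ∀ c, m * inner ℝ c c ≤ inner ℝ c (T c)) (hL : ‖T‖ ≤ L) :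
    ‖ContinuousLinearMap.id ℝ H - α • T‖ ≤ ρ := by
  refine ContinuousLinearMap.opNorm_le_bound _ hρ fun c => ?_
  refine le_of_sq_le_sq ?_ (by positivity)
  have h1 : ‖T c‖ ^ 2 ≤ (L * ‖c‖) ^ 2 := by
    gcongr
    exact T.le_of_opNorm_le hL c
  have h2 := hm c
  rw [real_inner_self_eq_norm_sq] at h2
  have h3 : ‖c - α • T c‖ ^ 2 = ‖c‖ ^ 2 - 2 * (α * inner ℝ c (T c)) + α ^ 2 * ‖T c‖ ^ 2 := by
    rw [norm_sub_sq_real, inner_smul_right, norm_smul, mul_pow, Real.norm_eq_abs, sq_abs]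
  have h4 := mul_le_mul_of_nonneg_left h1 (sq_nonneg α)
  have h5 := mul_le_mul_of_nonneg_left h2 hα
  have h6 := mul_le_mul_of_nonneg_right hρ' (sq_nonneg ‖c‖)
  simp only [sub_apply, ContinuousLinearMap.id_apply, smul_apply]
  rw [h3]
  nlinarith

/-- With `a = α m₀` and `b = α L`: the bound `√(1 - 2 α m₀ + α² L²)` for `‖I - α ∇f‖` in `B(ℓ²)` is
at most the rate `(1 - α + α² L + α² L²) / (1 - α + α m₀)`. -/
theorem rate_sq_bound {α a b : ℝ} (hα : 0 < α) (ha : 0 < a) (hab : a ≤ b)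
    (h : α * b + b ^ 2 < a) :
    (1 - 2 * a + b ^ 2) * (1 - α + a) ^ 2 ≤ (1 - α + α * b + b ^ 2) ^ 2 := by
  have hb : 0 < b := ha.trans_le hab
  have hαb : α + b < 1 := by nlinarith
  have e : (1 - α + α * b + b ^ 2) ^ 2 - (1 - 2 * a + b ^ 2) * (1 - α + a) ^ 2 =
      2 * α * (b - a) * (1 - α) + (b ^ 2 + 3 * a ^ 2 - 2 * a * b ^ 2 + 2 * a ^ 3 - 4 * a ^ 2 * α)
        + b ^ 2 * (b + a) * (2 * α + b - a) := by ring
  have h1 : 0 ≤ 2 * α * (b - a) * (1 - α) :=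
    mul_nonneg (mul_nonneg (by linarith) (by linarith)) (by linarith)
  have h2 : 0 ≤ b ^ 2 * (b + a) * (2 * α + b - a) := by
    have : 0 ≤ 2 * α + b - a := by linarith
    positivity
  have ha2 : a ^ 2 ≤ b ^ 2 := by gcongr
  have h3 : 0 ≤ b ^ 2 + 3 * a ^ 2 - 2 * a * b ^ 2 + 2 * a ^ 3 - 4 * a ^ 2 * α := by
    have ha3 : 0 < a ^ 3 := by positivity
    rcases le_total a (1 / 2) with h | h
    · -- here `b² (1 - 2a) ≥ a² (1 - 2a)`, and the rest is `4 a² (1 - α)`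
      nlinarith [mul_nonneg (sub_nonneg.2 ha2) (by linarith : 0 ≤ 1 - 2 * a),
        mul_nonneg (sq_nonneg a) (by linarith : 0 ≤ 1 - α)]
    · -- here `b² < a` gives `b² (1 - 2a) ≥ a (1 - 2a)`, and `α < 1 / 2`
      have hb2 : b ^ 2 ≤ a := by nlinarith
      nlinarith [mul_nonneg (sub_nonneg.2 hb2) (by linarith : 0 ≤ 2 * a - 1),
        mul_nonneg (sq_nonneg a) (by linarith : 0 ≤ 1 - 2 * α)]
  linarith

end Monotone

/-! ### Increments of a function with gradient in the matrix algebra -/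

section MeanValue

variable {N 𝒜 : Type*} [NormedRing 𝒜] [NormedAlgebra ℝ 𝒜] {entry : 𝒜 →ₗ[ℝ] Matrix N N ℝ}

namespace IsStrictlyMonotoneWithGradient

variable {p₀ : ℝ≥0∞} [Fact (1 ≤ p₀)] {f : SeqSpace N p₀ → SeqSpace N p₀} {G : SeqSpace N p₀ → 𝒜}
  {m₀ L M : ℝ}

/-- Mean value theorem: the matrix `∫₀¹ ∇f(x' + t (x - x')) dt` represents the increment of `f`, and
as an average of gradients it lies in every closed convex set that contains them. -/
theorem exists_sub_eq (h𝒜 : IsMatrixBanachAlgebra entry)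
    (hf : IsStrictlyMonotoneWithGradient entry p₀ f G m₀ L M) {S : Set 𝒜} (hS : Convex ℝ S)
    (hS' : IsClosed S) (hG : ∀ x, G x ∈ S) (x x' : SeqSpace N p₀) :
    ∃ A ∈ S, f x - f x' = h𝒜.toOp p₀ A (x - x') := by
  have := h𝒜.complete
  set γ : ℝ → 𝒜 := fun t => G (x' + t • (x - x')) with hγ
  have hγc : Continuous γ := hf.gradient_continuous.comp (by fun_prop)
  have hint : IntervalIntegrable γ MeasureTheory.volume 0 1 := hγc.intervalIntegrable 0 1
  let ev : 𝒜 →L[ℝ] SeqSpace N p₀ :=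
    (ContinuousLinearMap.apply ℝ (SeqSpace N p₀) (x - x')).comp (h𝒜.toOp p₀)
  have hderiv : ∀ t : ℝ, HasDerivAt (fun t : ℝ => f (x' + t • (x - x'))) (ev (γ t)) t := by
    intro t
    have h0 : HasDerivAt (fun s : ℝ => f (x' + t • (x - x') + s • (x - x'))) (ev (γ t)) (t - t) := by
      rw [sub_self]
      exact hf.gradient (x' + t • (x - x')) (x - x')
    have h1 := h0.comp_sub_const t t
    refine h1.congr_of_eventuallyEq (Eventually.of_forall fun s => ?_)
    dsimp only
    rw [add_assoc, ← add_smul, add_sub_cancel]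
  refine ⟨∫ t in (0 : ℝ)..1, γ t, ?_, ?_⟩
  · rw [intervalIntegral.integral_of_le zero_le_one]
    have : MeasureTheory.IsProbabilityMeasure
        (MeasureTheory.volume.restrict (Set.Ioc (0 : ℝ) 1)) := ⟨by simp⟩
    exact hS.integral_mem hS' (Eventually.of_forall fun t => hG _) hint.1
  · have hFTC := intervalIntegral.integral_eq_sub_of_hasDerivAt (fun t _ => hderiv t)
      ((ev.continuous.comp hγc).intervalIntegrable 0 1)
    rw [ContinuousLinearMap.intervalIntegral_comp_comm ev hint] at hFTC
    simpa [ev] using hFTC.symm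

/-- The matrices `A` that represent increments of `f` make `I - α A` bounded in `𝒜`, and contractive
in `B(ℓ²)` at the rate `ρ`. -/
theorem exists_sub_eq_norm_le (h𝒜 : IsMatrixBanachAlgebra entry)
    (hf : IsStrictlyMonotoneWithGradient entry p₀ f G m₀ L M) {α ρ : ℝ} (hα : 0 ≤ α)
    (hρ : 0 ≤ ρ) (hρ' : 1 - 2 * (α * m₀) + (α * L) ^ 2 ≤ ρ ^ 2) (x x' : SeqSpace N p₀) :
    ∃ A : 𝒜, (‖1 - α • A‖ ≤ ‖(1 : 𝒜)‖ + α * M ∧ ‖h𝒜.toOp 2 (1 - α • A)‖ ≤ ρ) ∧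
      f x - f x' = h𝒜.toOp p₀ A (x - x') := by
  have hball : ∀ A : 𝒜, (‖1 - α • A‖ ≤ ‖(1 : 𝒜)‖ + α * M ∧ ‖h𝒜.toOp 2 (1 - α • A)‖ ≤ ρ) ↔
      1 - α • A ∈ Metric.closedBall 0 (‖(1 : 𝒜)‖ + α * M) ∩
        h𝒜.toOp 2 ⁻¹' Metric.closedBall 0 ρ := by simp
  simp only [hball]
  refine hf.exists_sub_eq h𝒜 (S := (fun A : 𝒜 => 1 - α • A) ⁻¹' _) ?_ ?_ (fun z => ?_) x x'
  · have hconv : Convex ℝ (Metric.closedBall (0 : 𝒜) (‖(1 : 𝒜)‖ + α * M) ∩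
        h𝒜.toOp 2 ⁻¹' Metric.closedBall 0 ρ) :=
      (convex_closedBall _ _).inter
        ((convex_closedBall _ _).linear_preimage (h𝒜.toOp 2).toLinearMap)
    exact hconv.affine_preimage
      (AffineMap.const ℝ 𝒜 1 - (α • (LinearMap.id : 𝒜 →ₗ[ℝ] 𝒜)).toAffineMap)
  · exact (Metric.isClosed_closedBall.inter
      (Metric.isClosed_closedBall.preimage (h𝒜.toOp 2).continuous)).preimage (by fun_prop)
  · refine (hball (G z)).1 ⟨?_, ?_⟩
    · refine (norm_sub_le _ _).trans ?_
      rw [norm_smul, Real.norm_of_nonneg hα]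
      gcongr
      exact hf.gradient_bounded z
    · rw [map_sub, map_smul, h𝒜.toOp_one]
      exact norm_id_sub_smul_le hα hρ hρ' (hf.strictMono z) (hf.isLUB.1 ⟨z, rfl⟩)

/-- `m₀ ≤ L`, unless the index set is empty, in which case `L = 0`. -/
theorem le_of_ne_zero (hf : IsStrictlyMonotoneWithGradient entry p₀ f G m₀ L M) (hL : L ≠ 0) :
    m₀ ≤ L := by
  classical
  have hle := hf.isLUB.1 ⟨0, rfl⟩
  dsimp only at hle
  have : Nonempty N := by
    by_contra hN
    rw [not_nonempty_iff] at hN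
    refine hL (hf.isLUB.unique ?_)
    have : (Set.range fun x => ‖matrixOp 2 (entry (G x))‖) = {0} := by
      ext s
      simp [Subsingleton.elim (matrixOp 2 (entry (G _))) 0]
    rw [this]
    exact isLUB_singleton
  obtain ⟨i⟩ := this
  let c : SeqSpace N 2 := lp.single 2 i 1
  have hc : ‖c‖ = 1 := by simp [c, lp.norm_single]
  have h1 := hf.strictMono 0 c
  have h2 := (real_inner_le_norm c (matrixOp 2 (entry (G 0)) c)).trans
    (mul_le_mul_of_nonneg_left ((matrixOp 2 (entry (G 0))).le_opNorm c) (norm_nonneg c))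
  rw [real_inner_self_eq_norm_sq] at h1
  simp only [hc, one_pow, mul_one, one_mul] at h1 h2
  linarith

variable {p : ℝ≥0∞} [Fact (1 ≤ p)]

theorem exists_restrict (h𝒜 : IsMatrixBanachAlgebra entry)
    (hf : IsStrictlyMonotoneWithGradient entry p₀ f G m₀ L M) (hp : p ≤ p₀) :
    ∃ g : SeqSpace N p → SeqSpace N p, ∀ x, seqIncl N hp (g x) = f (seqIncl N hp x) := by
  have h : ∀ x : SeqSpace N p, ∃ z, seqIncl N hp z = f (seqIncl N hp x) := by
    intro x
    obtain ⟨A, -, hA⟩ := hf.exists_sub_eq h𝒜 convex_univ isClosed_univ (fun _ => Set.mem_univ _)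
      (seqIncl N hp x) 0
    refine ⟨h𝒜.toOp p A x, ?_⟩
    rw [h𝒜.seqIncl_toOp, ← sub_zero (f _), ← hf.map_zero, hA, sub_zero]
  choose g hg using h
  exact ⟨g, hg⟩

/-- The difference of two Van-Cittert sequences is the initial difference, multiplied by a product
of matrices `I - α A`, where the matrices `A` represent increments of `f`. -/
theorem exists_vanCittert_sub_eq (h𝒜 : IsMatrixBanachAlgebra entry)
    (hf : IsStrictlyMonotoneWithGradient entry p₀ f G m₀ L M) {α ρ : ℝ} (hα : 0 ≤ α)
    (hρ : 0 ≤ ρ) (hρ' : 1 - 2 * (α * m₀) + (α * L) ^ 2 ≤ ρ ^ 2) (hp : p ≤ p₀)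
    {g : SeqSpace N p → SeqSpace N p} (hg : ∀ x, seqIncl N hp (g x) = f (seqIncl N hp x))
    (y x x' : SeqSpace N p) (n : ℕ) :
    ∃ l : List 𝒜, l.length = n ∧
      (∀ B ∈ l, ‖B‖ ≤ ‖(1 : 𝒜)‖ + α * M ∧ ‖h𝒜.toOp 2 B‖ ≤ ρ) ∧
      vanCittert g α y x n - vanCittert g α y x' n = h𝒜.toOp p l.prod (x - x') := by
  induction n with
  | zero => exact ⟨[], rfl, by simp, by simp [vanCittert, h𝒜.toOp_one]⟩
  | succ n ih =>
    obtain ⟨l, hlen, hl, hprod⟩ := ih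
    set u := vanCittert g α y x n
    set v := vanCittert g α y x' n
    obtain ⟨A, hA, hsub⟩ := hf.exists_sub_eq_norm_le h𝒜 hα hρ hρ' (seqIncl N hp u)
      (seqIncl N hp v)
    have hguv : g u - g v = h𝒜.toOp p A (u - v) := by
      apply seqIncl_injective hp
      rw [h𝒜.seqIncl_toOp, map_sub, map_sub, hg, hg, hsub]
    refine ⟨(1 - α • A) :: l, by simp [hlen], ?_, ?_⟩
    · rintro B (_ | ⟨_, hB⟩)
      exacts [hA, hl B hB]
    · rw [List.prod_cons, h𝒜.toOp_mul, ContinuousLinearMap.comp_apply, ← hprod,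
        map_sub (h𝒜.toOp p), map_smul, h𝒜.toOp_one, sub_apply, smul_apply, ← hguv]
      simp only [vanCittert, ContinuousLinearMap.id_apply]
      change u - α • (g u - y) - (v - α • (g v - y)) = _
      module

end IsStrictlyMonotoneWithGradient

end MeanValue

/-! ### Convergence of the Van-Cittert iteration in `ℓ^p` -/

theorem mainTheorem4 {N : Type*} [Countable N]
    {𝒜 : Type*} [NormedRing 𝒜] [NormedAlgebra ℝ 𝒜] (entry : 𝒜 →ₗ[ℝ] Matrix N N ℝ)
    (h𝒜 : IsMatrixBanachAlgebra entry) (htranspose : ClosedUnderTranspose entry)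
    (hdecay : HasOffDiagonalDecay entry) (hdiff : HasDifferentialNorm entry)
    (p : ℝ≥0∞) [Fact (1 ≤ p)] (m₀ L M α : ℝ) (hm₀ : 0 < m₀)
    (hα : 0 < α) (hα' : α < m₀ / (L + L ^ 2)) :
    ∃ C₁ : ℝ → ℝ, (∀ r, 0 < C₁ r) ∧
      ∀ (p₀ : ℝ≥0∞) [Fact (1 ≤ p₀)] (_ : 2 ≤ p₀) (hp : p ≤ p₀)
        (f : SeqSpace N p₀ → SeqSpace N p₀) (G : SeqSpace N p₀ → 𝒜),
        IsStrictlyMonotoneWithGradient entry p₀ f G m₀ L M →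
        -- the restriction of `f` is an invertible function `F` on `ℓ^p`
        ∃ F : SeqSpace N p ≃ SeqSpace N p,
          (∀ x, seqIncl N hp (F x) = f (seqIncl N hp x)) ∧
          ∀ y x₀ : SeqSpace N p,
            -- exponential convergence in `ℓ^p` to the solution `F.symm y`
            Tendsto (vanCittert F α y x₀) atTop (𝓝 (F.symm y)) ∧
            (∃ C r : ℝ, 0 < r ∧ r < 1 ∧ ∀ n, ‖vanCittert F α y x₀ n - F.symm y‖ ≤ C * r ^ n) ∧
            -- the quantitative estimate
            ∀ r : ℝ, (1 - α + α ^ 2 * L + α ^ 2 * L ^ 2) / (1 - α + α * m₀) < r →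
              ∀ n, ‖vanCittert F α y x₀ n - F.symm y‖ ≤ C₁ r * ‖x₀ - F.symm y‖ * r ^ n := by
  -- If `m₀ ≤ L` or `0 < L` fails, then no admissible `f` exists, and any `C₁` will do.
  by_cases hL : 0 < L ∧ m₀ ≤ L
  swap
  · refine ⟨fun _ => 1, fun _ => one_pos, fun p₀ _ _ hp f G hf => absurd ?_ hL⟩
    have hL0 : L ≠ 0 := by
      rintro rfl
      simp only [ne_eq, OfNat.ofNat_ne_zero, not_false_eq_true, zero_pow, add_zero,
        div_zero] at hα'
      linarith
    have := hf.le_of_ne_zero hL0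
    exact ⟨hm₀.trans_le this, this⟩
  obtain ⟨hL0, hmL⟩ := hL
  set ρ : ℝ := (1 - α + α ^ 2 * L + α ^ 2 * L ^ 2) / (1 - α + α * m₀) with hρdef
  rw [lt_div_iff₀ (by positivity)] at hα'
  have hα1 : α < 1 := by
    by_contra! h
    nlinarith [mul_le_mul_of_nonneg_right h (by positivity : 0 ≤ L + L ^ 2)]
  have hden : 0 < 1 - α + α * m₀ := by
    have := mul_pos hα hm₀
    linarith
  have hnum : 0 < 1 - α + α ^ 2 * L + α ^ 2 * L ^ 2 := by
    have : 0 < α ^ 2 * L + α ^ 2 * L ^ 2 := by positivity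
    linarith
  have hρ0 : 0 < ρ := div_pos hnum hden
  have hab : α * (α * L) + (α * L) ^ 2 < α * m₀ := by
    have := mul_lt_mul_of_pos_left hα' hα
    linarith
  have hρ1 : ρ < 1 := by
    rw [hρdef, div_lt_one hden]
    linarith
  have hρ' : 1 - 2 * (α * m₀) + (α * L) ^ 2 ≤ ρ ^ 2 := by
    rw [hρdef, div_pow, le_div_iff₀ (by positivity)]
    refine (rate_sq_bound hα (mul_pos hα hm₀) (by gcongr) hab).trans_eq ?_
    ring
  have hprod : ∀ r : ℝ, ∃ C : ℝ, 0 < C ∧ (ρ < r → ∀ l : List 𝒜,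
      (∀ B ∈ l, ‖B‖ ≤ ‖(1 : 𝒜)‖ + α * M ∧ ‖h𝒜.toOp 2 B‖ ≤ ρ) → ‖l.prod‖ ≤ C * r ^ l.length) := by
    intro r
    by_cases hr : ρ < r
    · obtain ⟨C, hC, h⟩ := exists_norm_list_prod_le h𝒜 hdiff (K := ‖(1 : 𝒜)‖ + α * M) hρ0 hr
      exact ⟨C, hC, fun _ => h⟩
    · exact ⟨1, one_pos, fun h => absurd h hr⟩
  choose C hC hprod using hprod
  set κ : ℝ := ‖h𝒜.toOp p‖ + 1 with hκ
  have hκ0 : 0 < κ := by positivity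
  refine ⟨fun r => κ * C r, fun r => mul_pos hκ0 (hC r), fun p₀ _ _ hp f G hf => ?_⟩
  obtain ⟨g, hg⟩ := hf.exists_restrict h𝒜 hp
  have hcontr : ∀ r, ρ < r → ∀ y x x' : SeqSpace N p, ∀ n,
      ‖vanCittert g α y x n - vanCittert g α y x' n‖ ≤ κ * C r * ‖x - x'‖ * r ^ n := by
    intro r hr y x x' n
    obtain ⟨l, hlen, hl, hsub⟩ := hf.exists_vanCittert_sub_eq h𝒜 hα.le hρ0.le hρ' hp hg y x x' n
    have hl' := hprod r hr l hl
    rw [hlen] at hl'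
    have hop : ‖h𝒜.toOp p l.prod‖ ≤ κ * (C r * r ^ n) :=
      ((h𝒜.toOp p).le_opNorm_of_le hl').trans <| by
        have := hC r
        have := hρ0.trans hr
        gcongr
        linarith
    rw [hsub]
    refine ((h𝒜.toOp p l.prod).le_of_opNorm_le hop _).trans_eq ?_
    ring
  obtain ⟨r₁, hr₁, hr₁'⟩ := exists_between hρ1
  have hr₁0 : 0 < r₁ := hρ0.trans hr₁
  have hbij : Function.Bijective g :=
    bijective_of_vanCittert_contracting hα.ne' hr₁0.le hr₁' (hcontr r₁ hr₁)
  have hest : ∀ r, ρ < r → ∀ y x₀ : SeqSpace N p, ∀ n,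
      ‖vanCittert g α y x₀ n - (Equiv.ofBijective g hbij).symm y‖ ≤
        κ * C r * ‖x₀ - (Equiv.ofBijective g hbij).symm y‖ * r ^ n := by
    intro r hr y x₀ n
    have h := hcontr r hr y x₀ ((Equiv.ofBijective g hbij).symm y) n
    rwa [vanCittert_of_eq (Equiv.ofBijective_apply_symm_apply g hbij y)] at h
  refine ⟨Equiv.ofBijective g hbij, hg, fun y x₀ => ⟨?_, ⟨_, r₁, hr₁0, hr₁', hest r₁ hr₁ y x₀⟩,
    fun r hr => hest r hr y x₀⟩⟩
  refine tendsto_iff_norm_sub_tendsto_zero.2 (squeeze_zero (fun _ => norm_nonneg _)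
    (hest r₁ hr₁ y x₀) ?_)
  simpa using (tendsto_pow_atTop_nhds_zero_of_lt_one hr₁0.le hr₁').const_mul
    (κ * C r₁ * ‖x₀ - (Equiv.ofBijective g hbij).symm y‖)
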